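/- For a family $\mathcal F$ of sets and a set $S$, put $\mathcal F|_S=\{F\cap S: F\in\mathcal F\}$, and say that $\mathcal F$ \emph{almost shatters} $S$ if $\mathcal F|_S=2^S\setminus\{\emptyset\}$ or $\mathcal F|_S=2^S\setminus\{S\}$. Let $d=2k+1$ with $k\ge 1$, write $[2d]=\{1,\dots,2d\}$, let $X\subseteq[2d]$, and let $\mathcal F(X)$ be the family of all $d$-element subsets $F\subseteq[2d]$ such that $\sum_{i\in F} i$ is congruent modulo $2d$ to an element of $X$. Then $\mathcal F(X)$ almost shatters every $d$-element subset $S\subseteq[2d]$ if and only if the following three conditions hold: (1) $|X|=d$ and $X\cap(d-X)=\emptyset$ modulo $2d$, i.e. there are no $x,y\in X$ with $x\equiv d-y \pmod{2d}$; (2) $X$ contains both an odd and an even element; (3) for every $u\in X$, $\sum_{w\in X\setminus\{u\}} w\not\equiv 0 \pmod d$. -/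

import Mathlib

/-- The projection (trace) `𝓕|_S = {F ∩ S : F ∈ 𝓕}` of a family of finite sets onto `S`. -/
def familyTrace (𝓕 : Finset (Finset ℕ)) (S : Finset ℕ) : Finset (Finset ℕ) :=
  𝓕.image (fun F => F ∩ S)

/-- `𝓕` almost shatters `S` if its trace on `S` is `2^S` without `∅`, or `2^S` without `S`. -/
def AlmostShatters (𝓕 : Finset (Finset ℕ)) (S : Finset ℕ) : Prop :=
  familyTrace 𝓕 S = S.powerset \ {∅} ∨ familyTrace 𝓕 S = S.powerset \ {S}

/-- The family `𝓕(X)` of the `d`-element subsets of `[2d] = {1, …, 2d}` whose sum of elements is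
congruent modulo `2d` to an element of `X`. -/
def sumFamily (d : ℕ) (X : Finset ℕ) : Finset (Finset ℕ) :=
  {F ∈ (Finset.Icc 1 (2 * d)).powersetCard d | ∃ x ∈ X, ∑ i ∈ F, i ≡ x [MOD 2 * d]}

open Finset

theorem even_card_filter_matched {R : Type*} [AddCommGroup R] [DecidableEq R] (B : Finset R)
    (c : R) : Even {a ∈ B | c - a ∈ B ∧ c - a ≠ a}.card := by
  rw [← ZMod.natCast_eq_zero_iff_even, ← nsmul_one, ← Finset.sum_const]
  refine Finset.sum_involution (fun a _ => c - a) (fun a _ => by decide) ?_ ?_ ?_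
  · intro a ha _
    exact (mem_filter.1 ha).2.2
  · intro a ha
    obtain ⟨h1, h2, h3⟩ := mem_filter.1 ha
    refine mem_filter.2 ⟨h2, by simpa using h1, ?_⟩
    rw [sub_sub_cancel]
    exact h3.symm
  · intro a _
    exact sub_sub_cancel c a

theorem exists_subset_card_eq_noncrossing {R : Type*} [AddCommGroup R] [DecidableEq R]
    (B : Finset R) (c : R) (m : ℕ) (hm : 2 * m ≤ B.card) :
    ∃ V ⊆ B, V.card = 2 * m ∧ ∀ v ∈ V, ∀ b ∈ B \ V, v + b ≠ c := by
  induction m with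
  | zero => exact ⟨∅, by simp, by simp, by simp⟩
  | succ m ih =>
    obtain ⟨V, hVB, hV, hcr⟩ := ih (by omega)
    have hcard : (B \ V).card = B.card - 2 * m := by rw [card_sdiff_of_subset hVB, hV]
    have extend : ∀ p ∈ B \ V, ∀ q ∈ B \ V, p ≠ q →
        (∀ b ∈ B \ V, b ≠ p → b ≠ q → p + b ≠ c ∧ q + b ≠ c) →
        ∃ V ⊆ B, V.card = 2 * (m + 1) ∧ ∀ v ∈ V, ∀ b ∈ B \ V, v + b ≠ c := by
      intro p hp q hq hpq h
      have hp' := mem_sdiff.1 hp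
      have hq' := mem_sdiff.1 hq
      refine ⟨insert p (insert q V), ?_, ?_, ?_⟩
      · simp [insert_subset_iff, hp'.1, hq'.1, hVB]
      · rw [card_insert_of_notMem (by simp [hpq, hp'.2]), card_insert_of_notMem hq'.2, hV]
        ring
      · intro v hv b hb
        simp only [mem_sdiff, mem_insert, not_or] at hb
        have hb' : b ∈ B \ V := mem_sdiff.2 ⟨hb.1, hb.2.2.2⟩
        rcases mem_insert.1 hv with rfl | hv
        · exact (h b hb' hb.2.1 hb.2.2.1).1
        rcases mem_insert.1 hv with rfl | hv
        · exact (h b hb' hb.2.1 hb.2.2.1).2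
        · exact hcr v hv b hb'
    by_cases hpair : ∃ p ∈ B \ V, c - p ∈ B \ V ∧ c - p ≠ p
    · obtain ⟨p, hp, hq, hne⟩ := hpair
      refine extend p hp (c - p) hq hne.symm fun b _ h1 h2 => ⟨?_, ?_⟩
      · rintro rfl; simp at h2
      · intro h
        apply h1
        rw [← sub_eq_zero, ← sub_eq_zero.2 h]; abel
    · push Not at hpair
      obtain ⟨p, hp, q, hq, hpq⟩ := one_lt_card.1 (show 1 < (B \ V).card by omega)
      refine extend p hp q hq hpq fun b hb h1 h2 => ⟨?_, ?_⟩
      · rintro rfl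
        exact h1 (by simpa using hpair p hp (by simpa using hb))
      · rintro rfl
        exact h2 (by simpa using hpair q hq (by simpa using hb))

theorem forall_mem_exists_and_sum_eq_of_noncrossing {R : Type*} [CommRing R] [DecidableEq R]
    {A Y U : Finset R} (hAY : A.card = Y.card) (hU : U ⊆ A) {x y s : R}
    (hx : x ∈ A \ U) (hy : y ∈ A \ U) (hxy : x ≠ y)
    (hcr : ∀ u ∈ U, ∀ a ∈ A \ U, u + a ≠ x + y)
    (H : ∀ G ⊆ A, G.card = U.card + 1 → s + ∑ i ∈ G, i ∈ Y) :
    (∀ z ∈ Y, ∃ G ⊆ A, G.card = U.card + 1 ∧ z = s + ∑ i ∈ G, i) ∧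
      ∑ i ∈ Y, i = Y.card * (s + ∑ i ∈ U, i) + ∑ i ∈ A, i - 2 * ∑ i ∈ U, i
        + U.card * (x + y) := by
  set σ := ∑ i ∈ U, i with hσ
  set f : R → R := fun a => s + σ + a with hf
  set g : R → R := fun u => s + σ + (x + y - u) with hg
  have hfi : Function.Injective f := fun a b h => by simpa [hf] using h
  have hgi : Function.Injective g := fun a b h => by simpa [hg] using h
  have hfG : ∀ a ∈ A \ U, ∃ G ⊆ A, G.card = U.card + 1 ∧ f a = s + ∑ i ∈ G, i := by
    intro a ha
    have ha' := mem_sdiff.1 ha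
    refine ⟨insert a U, insert_subset ha'.1 hU, card_insert_of_notMem ha'.2, ?_⟩
    rw [sum_insert ha'.2]
    simp only [hf]; ring
  have hgG : ∀ u ∈ U, ∃ G ⊆ A, G.card = U.card + 1 ∧ g u = s + ∑ i ∈ G, i := by
    intro u hu
    have hx' := mem_sdiff.1 hx
    have hy' := mem_sdiff.1 hy
    have h1 : y ∉ U.erase u := fun h => hy'.2 (mem_of_mem_erase h)
    have h2 : x ∉ insert y (U.erase u) := by
      rw [mem_insert, not_or]
      exact ⟨hxy, fun h => hx'.2 (mem_of_mem_erase h)⟩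
    refine ⟨insert x (insert y (U.erase u)), ?_, ?_, ?_⟩
    · exact insert_subset hx'.1 (insert_subset hy'.1 ((erase_subset _ _).trans hU))
    · rw [card_insert_of_notMem h2, card_insert_of_notMem h1, card_erase_add_one hu]
    · have := add_sum_erase U (fun i => i) hu
      rw [sum_insert h2, sum_insert h1]
      simp only [hg, hσ, ← this]; ring
  have hdisj : Disjoint ((A \ U).image f) (U.image g) := by
    rw [disjoint_left]
    intro z h1 h2
    obtain ⟨a, ha, rfl⟩ := mem_image.1 h1
    obtain ⟨u, hu, h⟩ := mem_image.1 h2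
    refine hcr u hu a ha ?_
    simp only [hf, hg] at h
    linear_combination -h
  have hsub : (A \ U).image f ∪ U.image g ⊆ Y := by
    intro z hz
    rcases mem_union.1 hz with h | h
    · obtain ⟨a, ha, rfl⟩ := mem_image.1 h
      obtain ⟨G, h1, h2, h3⟩ := hfG a ha
      rw [h3]; exact H G h1 h2
    · obtain ⟨a, ha, rfl⟩ := mem_image.1 h
      obtain ⟨G, h1, h2, h3⟩ := hgG a ha
      rw [h3]; exact H G h1 h2
  have hY : (A \ U).image f ∪ U.image g = Y := by
    refine eq_of_subset_of_card_le hsub ?_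
    rw [card_union_of_disjoint hdisj, card_image_of_injective _ hfi,
      card_image_of_injective _ hgi, card_sdiff_add_card_eq_card hU, hAY]
  constructor
  · intro z hz
    rw [← hY] at hz
    rcases mem_union.1 hz with h | h
    · obtain ⟨a, ha, rfl⟩ := mem_image.1 h
      exact hfG a ha
    · obtain ⟨a, ha, rfl⟩ := mem_image.1 h
      exact hgG a ha
  · have hs := sum_sdiff hU (f := fun i => i)
    have hc : ((A \ U).card : R) + U.card = Y.card := by
      rw [← hAY, ← card_sdiff_add_card_eq_card hU]; push_cast; ring
    have hf' : ∑ a ∈ A \ U, f a = (A \ U).card * (s + σ) + ∑ a ∈ A \ U, a := by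
      rw [hf, Finset.sum_add_distrib, Finset.sum_const, nsmul_eq_mul]
    have hg' : ∑ u ∈ U, g u = U.card * (s + σ + (x + y)) - σ := by
      rw [hg, hσ, ← nsmul_eq_mul, ← Finset.sum_const, ← Finset.sum_sub_distrib]
      exact Finset.sum_congr rfl fun u _ => by ring
    rw [← hc, ← hs, ← hY, sum_union hdisj, sum_image hfi.injOn, sum_image hgi.injOn, hf', hg']
    ring

theorem ZMod.two_mul_natCast_self (d : ℕ) : (2 : ZMod (2 * d)) * d = 0 := by
  exact_mod_cast ZMod.natCast_self (2 * d)

theorem ZMod.natCast_half_ne_zero (d : ℕ) [NeZero d] : (d : ZMod (2 * d)) ≠ 0 := by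
  rw [Ne, ZMod.natCast_eq_zero_iff]
  intro h
  have := Nat.le_of_dvd (NeZero.pos d) h
  have := NeZero.pos d
  omega

theorem ZMod.half_mul_natCast_eq_zero_iff (d : ℕ) [NeZero d] (i : ℕ) :
    (d : ZMod (2 * d)) * i = 0 ↔ Even i := by
  rw [← Nat.cast_mul, ZMod.natCast_eq_zero_iff, mul_comm 2 d,
    Nat.mul_dvd_mul_iff_left (NeZero.pos d), even_iff_two_dvd]

theorem ZMod.two_mul_natCast_eq_zero_iff (d : ℕ) (i : ℕ) :
    (2 : ZMod (2 * d)) * i = 0 ↔ d ∣ i := by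
  rw [← Nat.mul_dvd_mul_iff_left two_pos, ← ZMod.natCast_eq_zero_iff]
  push_cast; rfl

theorem ZMod.half_mul_eq_zero_or (d : ℕ) [NeZero d] (z : ZMod (2 * d)) :
    (d : ZMod (2 * d)) * z = 0 ∨ (d : ZMod (2 * d)) * z = d := by
  obtain ⟨i, rfl⟩ := ZMod.natCast_zmod_surjective z
  rcases Nat.even_or_odd i with h | ⟨m, rfl⟩
  · exact Or.inl ((ZMod.half_mul_natCast_eq_zero_iff d i).2 h)
  · right
    push_cast
    linear_combination (m : ZMod (2 * d)) * ZMod.two_mul_natCast_self d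

theorem ZMod.card_filter_half_mul_eq_le (d : ℕ) [NeZero d] (p : ZMod (2 * d)) :
    ({z : ZMod (2 * d) | (d : ZMod (2 * d)) * z = p} : Finset _).card ≤ d := by
  set E : Finset (ZMod (2 * d)) := {z : ZMod (2 * d) | (d : ZMod (2 * d)) * z = p} with hE
  have hdisj : Disjoint E (E.image (· + 1)) := by
    rw [disjoint_left]
    intro z h1 h2
    obtain ⟨w, hw, rfl⟩ := mem_image.1 h2
    simp only [hE, mem_filter, mem_univ, true_and] at h1 hw
    exact ZMod.natCast_half_ne_zero d (by linear_combination h1 - hw)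
  have h := card_le_univ (E ∪ E.image (· + 1))
  rw [card_union_of_disjoint hdisj, card_image_of_injective _ (add_left_injective 1),
    ZMod.card] at h
  omega

theorem ZMod.half_mul_of_mul_self (d k : ℕ) (hd : d = 2 * k + 1) :
    (d : ZMod (2 * d)) * d = d := by
  have h := ZMod.two_mul_natCast_self d
  have hk : (d : ZMod (2 * d)) = 2 * k + 1 := by rw [hd]; push_cast; rfl
  linear_combination (d : ZMod (2 * d)) * hk + (k : ZMod (2 * d)) * h

theorem ZMod.eq_zero_of_half_sub_two_mul (d k : ℕ) (hd : d = 2 * k + 1) {z : ZMod (2 * d)}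
    (hz : ((d : ZMod (2 * d)) - 2) * z = 0) : z = 0 := by
  have h := ZMod.two_mul_natCast_self d
  have hk : (d : ZMod (2 * d)) = 2 * k + 1 := by
    exact_mod_cast congrArg (Nat.cast (R := ZMod (2 * d))) hd
  have h4 : 4 * z = 0 := by linear_combination z * h - 2 * hz
  have hz' : (2 * (k : ZMod (2 * d)) - 1) * z = 0 := by linear_combination hz - z * hk
  linear_combination (2 * (k : ZMod (2 * d)) - 1) * hz' - (k * (k - 1) : ZMod (2 * d)) * h4


/-- If the sums of the `j`-subsets of `A` lie, up to translation, in a set of half the size of the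
group, then every value taken by a sum of two distinct elements of `A` pairs up all but at most one
element of `A`. -/
theorem ZMod.unmatched_unique {d k j : ℕ} (hd : d = 2 * k + 1)
    {A Y : Finset (ZMod (2 * d))} (hA : A.card = d) (hY : Y.card = d) {s : ZMod (2 * d)}
    (hj : Even j) (hj2 : 2 ≤ j) (hjd : j + 2 ≤ d)
    (H : ∀ G ⊆ A, G.card = j → s + ∑ i ∈ G, i ∈ Y)
    {x y : ZMod (2 * d)} (hx : x ∈ A) (hy : y ∈ A) (hxy : x ≠ y)
    {w w' : ZMod (2 * d)} (hw : w ∈ A) (hw' : w' ∈ A)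
    (hwu : ∀ a ∈ A, a ≠ w → w + a ≠ x + y) (hwu' : ∀ a ∈ A, a ≠ w' → w' + a ≠ x + y) :
    w = w' := by
  by_contra hne
  obtain ⟨m, rfl⟩ := hj
  have hwx : w ≠ x := by rintro rfl; exact hwu y hy hxy.symm rfl
  have hwy : w ≠ y := by rintro rfl; exact hwu x hx hxy (add_comm _ _)
  have hwx' : w' ≠ x := by rintro rfl; exact hwu' y hy hxy.symm rfl
  have hwy' : w' ≠ y := by rintro rfl; exact hwu' x hx hxy (add_comm _ _)
  set B := (((A.erase x).erase y).erase w).erase w' with hB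
  have hBmem : ∀ b, b ∈ B ↔ b ≠ w' ∧ b ≠ w ∧ b ≠ y ∧ b ≠ x ∧ b ∈ A := by
    intro b; simp only [hB, mem_erase]
  have hBc : B.card = d - 4 := by
    rw [hB, card_erase_of_mem, card_erase_of_mem, card_erase_of_mem, card_erase_of_mem hx, hA]
    · omega
    all_goals simp_all [Ne.symm]
  obtain ⟨V, hVB, hV, hcr⟩ :=
    exists_subset_card_eq_noncrossing B (x + y) (m - 1) (by omega)
  have hV' : ∀ v ∈ V, v ≠ w' ∧ v ≠ w ∧ v ≠ y ∧ v ≠ x ∧ v ∈ A := fun v hv =>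
    (hBmem v).1 (hVB hv)
  have key : ∀ u u' : ZMod (2 * d), u ∈ A → u' ∈ A → u ≠ x → u ≠ y →
      (∀ a ∈ A, a ≠ u → u + a ≠ x + y) → (∀ a ∈ A, a ≠ u' → u' + a ≠ x + y) → u ∉ V →
      (∀ b ∈ A, b ≠ u → b ≠ u' → b ≠ x → b ≠ y → b ∈ B) →
      ∑ i ∈ Y, i = Y.card * (s + (u + ∑ i ∈ V, i)) + ∑ i ∈ A, i - 2 * (u + ∑ i ∈ V, i)
        + (V.card + 1 : ℕ) * (x + y) := by
    intro u u' hu hu' hux huy hun hun' huV hmem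
    have hc := card_insert_of_notMem huV
    have := (forall_mem_exists_and_sum_eq_of_noncrossing (A := A) (Y := Y) (U := insert u V)
      (hA.trans hY.symm) ?_ (x := x) (y := y) (s := s) ?_ ?_ hxy ?_ ?_).2
    · rwa [sum_insert huV, hc] at this
    · exact insert_subset hu fun v hv => (hV' v hv).2.2.2.2
    · simp only [mem_sdiff, mem_insert, not_or]
      exact ⟨hx, hux.symm, fun h => (hV' x h).2.2.2.1 rfl⟩
    · simp only [mem_sdiff, mem_insert, not_or]
      exact ⟨hy, huy.symm, fun h => (hV' y h).2.2.1 rfl⟩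
    · intro v hv a ha
      simp only [mem_sdiff, mem_insert, not_or] at ha
      rcases mem_insert.1 hv with rfl | hv
      · exact hun a ha.1 ha.2.1
      have hv' := hV' v hv
      by_cases hau : a = u'
      · rw [hau, add_comm]
        refine hun' v hv'.2.2.2.2 ?_
        rintro rfl
        exact ha.2.2 (hau ▸ hv)
      by_cases hax : a = x
      · rw [hax, add_comm]
        exact fun h => hv'.2.2.1 (add_left_cancel h)
      by_cases hay : a = y
      · rw [hay]
        exact fun h => hv'.2.2.2.1 (add_right_cancel h)
      exact hcr v hv a (mem_sdiff.2 ⟨hmem a ha.1 ha.2.1 hau hax hay, ha.2.2⟩)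
    · intro G hG hGc
      refine H G hG ?_
      rw [hGc, hc, hV]; omega
  have h1 := key w w' hw hw' hwx hwy hwu hwu' (fun h => (hV' w h).2.1 rfl)
    fun b h1 h2 h3 h4 h5 => (hBmem b).2 ⟨h3, h2, h5, h4, h1⟩
  have h2 := key w' w hw' hw hwx' hwy' hwu' hwu (fun h => (hV' w' h).1 rfl)
    fun b h1 h2 h3 h4 h5 => (hBmem b).2 ⟨h2, h3, h5, h4, h1⟩
  rw [hY] at h1 h2
  refine hne (sub_eq_zero.1 (ZMod.eq_zero_of_half_sub_two_mul d k hd ?_))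
  linear_combination h2 - h1

theorem ZMod.half_mul_eq_of_ne_of_ne {d : ℕ} [NeZero d] {a b x : ZMod (2 * d)}
    (hab : (d : ZMod (2 * d)) * a ≠ d * b) (hxa : (d : ZMod (2 * d)) * x ≠ d * a) :
    (d : ZMod (2 * d)) * x = d * b := by
  have ha := ZMod.half_mul_eq_zero_or d a
  have hb := ZMod.half_mul_eq_zero_or d b
  have hx := ZMod.half_mul_eq_zero_or d x
  generalize (d : ZMod (2 * d)) * a = u at *
  generalize (d : ZMod (2 * d)) * b = v at *
  generalize (d : ZMod (2 * d)) * x = w at *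
  rcases ha with rfl | rfl <;> rcases hb with rfl | rfl <;> rcases hx with rfl | rfl <;>
    first | rfl | exact absurd rfl hab | exact absurd rfl hxa

/-- Under the hypotheses of `ZMod.unmatched_unique`, all elements of `A` have the same parity. -/
theorem ZMod.half_mul_eq_of_subset_sums_mem {d k j : ℕ} [NeZero d] (hd : d = 2 * k + 1)
    {A Y : Finset (ZMod (2 * d))} (hA : A.card = d) (hY : Y.card = d) {s : ZMod (2 * d)}
    (hj : Even j) (hj2 : 2 ≤ j) (hjd : j + 2 ≤ d)
    (H : ∀ G ⊆ A, G.card = j → s + ∑ i ∈ G, i ∈ Y) :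
    ∀ a ∈ A, ∀ b ∈ A, (d : ZMod (2 * d)) * a = d * b := by
  by_contra! hcon
  obtain ⟨a, ha, b, hb, hab⟩ := hcon
  have h2d := ZMod.two_mul_natCast_self d
  have hk : (d : ZMod (2 * d)) = 2 * k + 1 := by
    exact_mod_cast congrArg (Nat.cast (R := ZMod (2 * d))) hd
  have huniq := fun {x y : ZMod (2 * d)} (hx : x ∈ A) (hy : y ∈ A) (hxy : x ≠ y)
      {w w' : ZMod (2 * d)} => ZMod.unmatched_unique hd hA hY hj hj2 hjd H hx hy hxy
        (w := w) (w' := w')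
  have hzo := ZMod.half_mul_eq_zero_or d
  have hsum : ({x ∈ A | (d : ZMod (2 * d)) * x = d * a} : Finset _).card +
      ({x ∈ A | (d : ZMod (2 * d)) * x = d * b} : Finset _).card = d := by
    refine Eq.trans ?_ hA
    rw [← card_filter_add_card_filter_not (s := A) (fun x => (d : ZMod (2 * d)) * x = d * a)]
    congr 2
    refine filter_congr fun x _ => ⟨fun h h' => hab (h'.symm.trans h), fun h => ?_⟩
    exact ZMod.half_mul_eq_of_ne_of_ne hab h
  -- an odd value pairs the two parity classes with each other
  have hle : ∀ p q : ZMod (2 * d), p ∈ A → q ∈ A → (d : ZMod (2 * d)) * p ≠ d * q →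
      ({x ∈ A | (d : ZMod (2 * d)) * x = d * p} : Finset _).card ≤
        ({x ∈ A | (d : ZMod (2 * d)) * x = d * q} : Finset _).card + 1 := by
    intro p q hp hq hpq
    set P := {x ∈ A | (d : ZMod (2 * d)) * x = d * p} with hP
    set Q := {x ∈ A | (d : ZMod (2 * d)) * x = d * q} with hQ
    have hne : p ≠ q := fun h => hpq (by rw [h])
    have h1 : ({x ∈ P | p + q - x ∈ A} : Finset _).card ≤ Q.card := by
      refine card_le_card_of_injOn (fun x => p + q - x) ?_ (fun x _ y _ h => by simpa using h)
      intro x hx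
      simp only [hP, hQ, mem_coe, mem_filter] at hx ⊢
      exact ⟨hx.2, by linear_combination - hx.1.2⟩
    have h2 : ({x ∈ P | p + q - x ∉ A} : Finset _).card ≤ 1 := by
      refine card_le_one.2 fun w hw w' hw' => ?_
      simp only [hP, mem_filter] at hw hw'
      refine huniq hp hq hne hw.1.1 hw'.1.1 (fun a ha _ h => hw.2 ?_) (fun a ha _ h => hw'.2 ?_)
      · rwa [← h, add_sub_cancel_left]
      · rwa [← h, add_sub_cancel_left]
    have := card_filter_add_card_filter_not (s := P) (fun x => p + q - x ∈ A)
    omega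
  have hle1 := hle a b ha hb hab
  have hle2 := hle b a hb ha (Ne.symm hab)
  -- an even value pairs up the elements of the parity class of even size
  have heven : ∀ p ∈ A, Even ({x ∈ A | (d : ZMod (2 * d)) * x = d * p} : Finset _).card →
      ∀ x ∈ A, ∀ y ∈ A, x ≠ y → (d : ZMod (2 * d)) * x = d * y →
      (({x ∈ A | (d : ZMod (2 * d)) * x = d * p} : Finset _).card : ZMod (2 * d)) * (x + y)
        = 2 * ∑ i ∈ A with (d : ZMod (2 * d)) * i = d * p, i := by
    intro p hp hev x hx y hy hxy hpar
    set B := {x ∈ A | (d : ZMod (2 * d)) * x = d * p} with hB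
    have hdc : (d : ZMod (2 * d)) * (x + y) = 0 := by linear_combination hpar + y * h2d
    have hrefl : ∀ u ∈ B, ∀ v ∈ A, u + v = x + y → v ∈ B := by
      intro u hu v hv huv
      have hu' := (mem_filter.1 hu).2
      refine mem_filter.2 ⟨hv, ?_⟩
      linear_combination (d : ZMod (2 * d)) * huv + hdc - hu' - p * h2d
    have hcard := card_filter_add_card_filter_not (s := B)
      (fun z => x + y - z ∈ B ∧ x + y - z ≠ z)
    have hev' := even_card_filter_matched B (x + y)
    have hone : ({z ∈ B | ¬ (x + y - z ∈ B ∧ x + y - z ≠ z)} : Finset _).card ≤ 1 := by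
      refine card_le_one.2 fun w hw w' hw' => ?_
      rw [mem_filter] at hw hw'
      refine huniq hx hy hxy (mem_filter.1 hw.1).1 (mem_filter.1 hw'.1).1
        (fun a ha hne h => hw.2 ?_) (fun a ha hne h => hw'.2 ?_)
      · rw [← h, add_sub_cancel_left]
        exact ⟨hrefl _ hw.1 _ ha h, hne⟩
      · rw [← h, add_sub_cancel_left]
        exact ⟨hrefl _ hw'.1 _ ha h, hne⟩
    have hzero : ({z ∈ B | ¬ (x + y - z ∈ B ∧ x + y - z ≠ z)} : Finset _).card = 0 := by
      rw [← hcard] at hev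
      obtain ⟨m, hm⟩ := hev
      obtain ⟨n, hn⟩ := hev'
      omega
    have hall : ∀ z ∈ B, x + y - z ∈ B := by
      intro z hz
      by_contra h
      have : z ∈ {z ∈ B | ¬ (x + y - z ∈ B ∧ x + y - z ≠ z)} :=
        mem_filter.2 ⟨hz, fun h' => h h'.1⟩
      rw [card_eq_zero.1 hzero] at this
      simp at this
    have hs : ∑ z ∈ B, (x + y - z) = ∑ z ∈ B, z :=
      Finset.sum_nbij' (fun z => x + y - z) (fun z => x + y - z) hall hall
        (fun z _ => sub_sub_cancel _ z) (fun z _ => sub_sub_cancel _ z) (fun z _ => rfl)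
    rw [Finset.sum_sub_distrib, Finset.sum_const, nsmul_eq_mul] at hs
    linear_combination hs
  -- hence there is only one even value
  have hcancel : ∀ n : ℕ, (n = k ∨ n = k + 1) → ∀ u v : ZMod (2 * d),
      (d : ZMod (2 * d)) * u = d * v → (n : ZMod (2 * d)) * u = n * v → u = v := by
    rintro n (rfl | rfl) u v h1 h2
    · linear_combination h1 - 2 * h2 - (u - v) * hk
    · push_cast at h2
      linear_combination 2 * h2 - h1 + (u - v) * hk
  obtain ⟨p, hp, hpe, hpc⟩ : ∃ p ∈ A,
      Even ({x ∈ A | (d : ZMod (2 * d)) * x = d * p} : Finset _).card ∧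
      (({x ∈ A | (d : ZMod (2 * d)) * x = d * p} : Finset _).card = k ∨
        ({x ∈ A | (d : ZMod (2 * d)) * x = d * p} : Finset _).card = k + 1) := by
    rcases Nat.even_or_odd ({x ∈ A | (d : ZMod (2 * d)) * x = d * a} : Finset _).card with h | h
    · exact ⟨a, ha, h, by omega⟩
    · refine ⟨b, hb, ?_, by omega⟩
      obtain ⟨m, hm⟩ := h
      exact ⟨k - m, by omega⟩
  obtain ⟨q, hq3⟩ : ∃ q, 2 < ({x ∈ A | (d : ZMod (2 * d)) * x = d * q} : Finset _).card := by
    obtain ⟨m, rfl⟩ := hj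
    rcases le_total ({x ∈ A | (d : ZMod (2 * d)) * x = d * a} : Finset _).card
      ({x ∈ A | (d : ZMod (2 * d)) * x = d * b} : Finset _).card with h | h
    · exact ⟨b, by omega⟩
    · exact ⟨a, by omega⟩
  obtain ⟨x, y, z, hx, hy, hz, hxy, hxz, hyz⟩ := two_lt_card_iff.1 hq3
  rw [mem_filter] at hx hy hz
  have e1 := heven p hp hpe x hx.1 y hy.1 hxy (hx.2.trans hy.2.symm)
  have e2 := heven p hp hpe x hx.1 z hz.1 hxz (hx.2.trans hz.2.symm)
  refine hyz (add_left_cancel (hcancel _ hpc (x + y) (x + z) ?_ (e1.trans e2.symm)))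
  linear_combination hy.2 - hz.2

theorem ZMod.half_mul_eq_of_even_subset_sums_mem {d k j : ℕ} [NeZero d] (hd : d = 2 * k + 1)
    {A Y : Finset (ZMod (2 * d))} (hA : A.card = d) (hY : Y.card = d) {s : ZMod (2 * d)}
    (hj : Even j) (hj2 : 2 ≤ j) (hjd : j + 2 ≤ d)
    (H : ∀ G ⊆ A, G.card = j → s + ∑ i ∈ G, i ∈ Y) :
    ∀ y ∈ Y, ∀ z ∈ Y, (d : ZMod (2 * d)) * y = d * z := by
  have hpar := ZMod.half_mul_eq_of_subset_sums_mem hd hA hY hj hj2 hjd H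
  obtain ⟨m, rfl⟩ := hj
  obtain ⟨x, y, hx, hy, hxy⟩ := one_lt_card_iff.1 (show 1 < A.card by omega)
  have hnot : ¬ ∀ w ∈ A, x + y - w ∈ A ∧ x + y - w ≠ w := by
    intro h
    have := even_card_filter_matched A (x + y)
    rw [filter_true_of_mem h, hA] at this
    obtain ⟨n, hn⟩ := this
    omega
  push Not at hnot
  obtain ⟨w, hw, hwu⟩ := hnot
  have hwu' : ∀ a ∈ A, a ≠ w → w + a ≠ x + y := by
    intro a ha hne h
    rw [← h, add_sub_cancel_left] at hwu
    exact hne (hwu ha)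
  have hwx : w ≠ x := by rintro rfl; exact hwu' y hy hxy.symm rfl
  have hwy : w ≠ y := by rintro rfl; exact hwu' x hx hxy (add_comm _ _)
  have hBc : (((A.erase x).erase y).erase w).card = d - 3 := by
    rw [card_erase_of_mem, card_erase_of_mem, card_erase_of_mem hx, hA]
    · omega
    all_goals simp_all [Ne.symm]
  obtain ⟨V, hVB, hV, hcr⟩ :=
    exists_subset_card_eq_noncrossing (((A.erase x).erase y).erase w) (x + y) (m - 1) (by omega)
  have hV' : ∀ v ∈ V, v ≠ w ∧ v ≠ y ∧ v ≠ x ∧ v ∈ A := fun v hv => by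
    simpa only [mem_erase] using hVB hv
  have hwV : w ∉ V := fun h => (hV' w h).1 rfl
  have hc := card_insert_of_notMem hwV
  have hcm : (insert w V).card + 1 = m + m := by omega
  have hYG : ∀ z ∈ Y, ∃ G ⊆ A, G.card = (insert w V).card + 1 ∧ z = s + ∑ i ∈ G, i := by
    refine (forall_mem_exists_and_sum_eq_of_noncrossing (A := A) (Y := Y) (U := insert w V)
      (hA.trans hY.symm) ?_ (x := x) (y := y) (s := s) ?_ ?_ hxy ?_ (by rwa [hcm])).1
    · exact insert_subset hw fun v hv => (hV' v hv).2.2.2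
    · simp only [mem_sdiff, mem_insert, not_or]
      exact ⟨hx, hwx.symm, fun h => (hV' x h).2.2.1 rfl⟩
    · simp only [mem_sdiff, mem_insert, not_or]
      exact ⟨hy, hwy.symm, fun h => (hV' y h).2.1 rfl⟩
    · intro v hv a ha
      simp only [mem_sdiff, mem_insert, not_or] at ha
      rcases mem_insert.1 hv with rfl | hv
      · exact hwu' a ha.1 ha.2.1
      have hv' := hV' v hv
      by_cases hax : a = x
      · rw [hax, add_comm]
        exact fun h => hv'.2.1 (add_left_cancel h)
      by_cases hay : a = y
      · rw [hay]
        exact fun h => hv'.2.2.1 (add_right_cancel h)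
      exact hcr v hv a (by simp [ha, hax, hay])
  have hval : ∀ z ∈ Y, (d : ZMod (2 * d)) * z = d * s + (m + m : ℕ) * (d * x) := by
    intro z hz
    obtain ⟨G, hG, hGc, rfl⟩ := hYG z hz
    rw [mul_add, mul_sum, Finset.sum_congr rfl fun i hi => hpar i (hG hi) x hx,
      Finset.sum_const, hGc, hcm, nsmul_eq_mul]
  exact fun y hy z hz => (hval y hy).trans (hval z hz).symm

theorem ZMod.half_mul_eq_of_subset_sums_mem_half {d k j : ℕ} [NeZero d] (hd : d = 2 * k + 1)
    {A Y : Finset (ZMod (2 * d))} (hA : A.card = d) (hY : Y.card = d) {s : ZMod (2 * d)}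
    (hj2 : 2 ≤ j) (hjd : j + 2 ≤ d)
    (H : ∀ G ⊆ A, G.card = j → s + ∑ i ∈ G, i ∈ Y) :
    ∀ y ∈ Y, ∀ z ∈ Y, (d : ZMod (2 * d)) * y = d * z := by
  rcases Nat.even_or_odd j with hj | hj
  · exact ZMod.half_mul_eq_of_even_subset_sums_mem hd hA hY hj hj2 hjd H
  set f : ZMod (2 * d) → ZMod (2 * d) := fun y => s + ∑ i ∈ A, i - y with hf
  have hfi : Function.Injective f := fun a b h => by simpa [hf] using h
  have := ZMod.half_mul_eq_of_even_subset_sums_mem (Y := Y.image f) (s := 0) (j := d - j) hd hA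
    ((card_image_of_injective _ hfi).trans hY) ?_ (by omega) (by omega) ?_
  · intro y hy z hz
    have h := this (f y) (mem_image_of_mem f hy) (f z) (mem_image_of_mem f hz)
    simp only [hf] at h
    linear_combination -h
  · obtain ⟨m, rfl⟩ := hj
    exact ⟨k - m, by omega⟩
  · intro G hG hGc
    refine mem_image.2 ⟨_, H (A \ G) sdiff_subset ?_, ?_⟩
    · rw [card_sdiff_of_subset hG, hGc]; omega
    · have := sum_sdiff hG (f := fun i => i)
      simp only [hf]
      linear_combination -this

theorem ZMod.card_filter_half_mul_eq {d : ℕ} [NeZero d] {p : ZMod (2 * d)} (hp : p = 0 ∨ p = d) :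
    ({z : ZMod (2 * d) | (d : ZMod (2 * d)) * z = p} : Finset _).card = d := by
  have h := card_filter_add_card_filter_not (s := (univ : Finset (ZMod (2 * d))))
    (fun z => (d : ZMod (2 * d)) * z = 0)
  have h' : ({z : ZMod (2 * d) | ¬ (d : ZMod (2 * d)) * z = 0} : Finset (ZMod (2 * d))) =
      ({z : ZMod (2 * d) | (d : ZMod (2 * d)) * z = d} : Finset (ZMod (2 * d))) := by
    refine filter_congr fun z _ => ⟨(ZMod.half_mul_eq_zero_or d z).resolve_left, fun h1 h2 => ?_⟩
    exact ZMod.natCast_half_ne_zero d (h1.symm.trans h2)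
  rw [h', card_univ, ZMod.card] at h
  have h0 := ZMod.card_filter_half_mul_eq_le d 0
  have h1 := ZMod.card_filter_half_mul_eq_le d d
  rcases hp with rfl | rfl <;> omega

theorem ZMod.sum_univ_two_mul (d : ℕ) [NeZero d] : ∑ z : ZMod (2 * d), z = d := by
  have h : ∑ i ∈ range (2 * d), (i : ZMod (2 * d)) = ∑ z : ZMod (2 * d), z :=
    Finset.sum_nbij' (fun i => (i : ZMod (2 * d))) ZMod.val (fun _ _ => mem_univ _)
      (fun z _ => mem_range.2 (ZMod.val_lt z))
      (fun i hi => ZMod.val_cast_of_lt (mem_range.1 hi)) (fun z _ => ZMod.natCast_zmod_val z)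
      (fun _ _ => rfl)
  have hd := NeZero.pos d
  have hg : ∑ i ∈ range (2 * d), i = d * (2 * d - 1) := by
    refine Nat.eq_of_mul_eq_mul_right two_pos ?_
    rw [sum_range_id_mul_two]; ring
  rw [← h, ← Nat.cast_sum, hg, Nat.cast_mul, Nat.cast_sub (by omega)]
  push_cast
  linear_combination ((d : ZMod (2 * d)) - 1) * ZMod.two_mul_natCast_self d

theorem ZMod.sum_compl_two_mul {d : ℕ} [NeZero d] (S : Finset (ZMod (2 * d))) :
    ∑ i ∈ Sᶜ, i = d - ∑ i ∈ S, i := by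
  rw [← ZMod.sum_univ_two_mul, ← sum_add_sum_compl S, add_sub_cancel_left]

theorem Finset.sum_image_add_right {R : Type*} [CommRing R] [DecidableEq R] (B : Finset R)
    (e : R) : ∑ i ∈ B.image (· + e), i = ∑ i ∈ B, i + B.card * e := by
  rw [sum_image (add_left_injective e).injOn, Finset.sum_add_distrib, Finset.sum_const,
    nsmul_eq_mul]

theorem Finset.card_image_add_right {R : Type*} [AddGroup R] [DecidableEq R] (B : Finset R)
    (e : R) : (B.image (· + e)).card = B.card :=
  card_image_of_injective _ (add_left_injective e)

theorem ZMod.exists_card_eq_sum_eq {d k : ℕ} [NeZero d] (hd : d = 2 * k + 1)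
    (r : ZMod (2 * d)) : ∃ S : Finset (ZMod (2 * d)), S.card = d ∧ ∑ i ∈ S, i = r := by
  have h2d := ZMod.two_mul_natCast_self d
  have hdd := ZMod.half_mul_of_mul_self d k hd
  set B : Finset (ZMod (2 * d)) := ({z | (d : ZMod (2 * d)) * z = 0} : Finset _).erase 0 with hB
  have hBc : B.card + 1 = d := by
    rw [hB, card_erase_add_one (by simp), ZMod.card_filter_half_mul_eq (Or.inl rfl)]
  have hBp : ∀ z ∈ B, (d : ZMod (2 * d)) * z = 0 := fun z hz =>
    (mem_filter.1 (mem_of_mem_erase hz)).2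
  by_cases hz : r - ∑ i ∈ B, i ∈ B
  · have hz' : r - ∑ i ∈ B, i + d ∉ B := by
      intro h
      exact ZMod.natCast_half_ne_zero d (by linear_combination hBp _ h - hBp _ hz - hdd)
    have hc := card_insert_of_notMem hz'
    refine ⟨(insert (r - ∑ i ∈ B, i + d) B).image (· + 1), ?_, ?_⟩
    · rw [card_image_add_right, hc, hBc]
    · rw [sum_image_add_right, sum_insert hz', hc, hBc]
      linear_combination h2d
  · refine ⟨insert (r - ∑ i ∈ B, i) B, ?_, ?_⟩
    · rw [card_insert_of_notMem hz, hBc]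
    · rw [sum_insert hz, sub_add_cancel]

theorem ZMod.conditions_of_traces {d k : ℕ} [NeZero d] (hd : d = 2 * k + 1) (hk : 1 ≤ k)
    {X : Finset (ZMod (2 * d))}
    (H : ∀ S : Finset (ZMod (2 * d)), S.card = d →
      (∀ T ⊆ S, T ≠ ∅ → T ≠ S → ∃ F, F.card = d ∧ ∑ i ∈ F, i ∈ X ∧ F ∩ S = T) ∧
        (∑ i ∈ S, i ∈ X ↔ ∑ i ∈ Sᶜ, i ∉ X)) :
    (X.card = d ∧ ∀ x ∈ X, ∀ y ∈ X, x ≠ d - y) ∧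
      ((∃ x ∈ X, (d : ZMod (2 * d)) * x = d) ∧ ∃ x ∈ X, (d : ZMod (2 * d)) * x = 0) ∧
      ∀ u ∈ X, 2 * ∑ w ∈ X.erase u, w ≠ 0 := by
  have h2d := ZMod.two_mul_natCast_self d
  have hkd : (d : ZMod (2 * d)) = 2 * k + 1 := by
    exact_mod_cast congrArg (Nat.cast (R := ZMod (2 * d))) hd
  have hmem : ∀ r, r ∈ X ↔ d - r ∉ X := by
    intro r
    obtain ⟨S, hS, rfl⟩ := ZMod.exists_card_eq_sum_eq hd r
    rw [← ZMod.sum_compl_two_mul]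
    exact (H S hS).2
  have hcard : X.card = d := by
    have h1 : Xᶜ = X.image (fun x => (d : ZMod (2 * d)) - x) := by
      ext r
      rw [mem_compl, mem_image]
      constructor
      · intro h
        refine ⟨d - r, ?_, sub_sub_cancel _ _⟩
        by_contra h'
        exact h ((hmem r).2 h')
      · rintro ⟨x, hx, rfl⟩
        exact (hmem x).1 hx
    have h2 := card_compl X
    rw [h1, card_image_of_injective _ sub_right_injective, ZMod.card] at h2
    have := card_le_univ X
    rw [ZMod.card] at this
    omega
  have hparity : ∀ p : ZMod (2 * d), p = 0 ∨ p = d → ∃ x ∈ X, (d : ZMod (2 * d)) * x = p := by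
    intro p hp
    set S : Finset (ZMod (2 * d)) := {z : ZMod (2 * d) | (d : ZMod (2 * d)) * z = p} with hS
    have hSc : S.card = d := ZMod.card_filter_half_mul_eq hp
    obtain ⟨t, ht⟩ := card_pos.1 (show 0 < S.card by omega)
    obtain ⟨F, hF, hFX, hFS⟩ := (H S hSc).1 {t} (singleton_subset_iff.2 ht)
      (singleton_ne_empty t) (fun h => by rw [← h, card_singleton] at hSc; omega)
    refine ⟨_, hFX, ?_⟩
    have htp : (d : ZMod (2 * d)) * t = p := (mem_filter.1 ht).2
    have hsd : ∀ i ∈ F \ S, (d : ZMod (2 * d)) * i = p + d := by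
      intro i hi
      have hi' : (d : ZMod (2 * d)) * i ≠ p := fun h =>
        (mem_sdiff.1 hi).2 (mem_filter.2 ⟨mem_univ _, h⟩)
      rcases hp with rfl | rfl
      · rw [zero_add]
        exact (ZMod.half_mul_eq_zero_or d i).resolve_left hi'
      · rw [(ZMod.half_mul_eq_zero_or d i).resolve_right hi', ← two_mul, h2d]
    have hc := card_sdiff_add_card_inter F S
    rw [hFS, hF, card_singleton] at hc
    have hc' : (F \ S).card = 2 * k := by omega
    have hsum := sum_inter_add_sum_sdiff F S (fun i => (d : ZMod (2 * d)) * i)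
    rw [hFS, sum_singleton, sum_congr rfl hsd, Finset.sum_const, hc', nsmul_eq_mul,
      ← mul_sum, htp] at hsum
    rw [← hsum, ← htp]
    push_cast
    linear_combination (k : ZMod (2 * d)) * (t + 1) * h2d
  refine ⟨⟨hcard, ?_⟩, ⟨hparity d (Or.inr rfl), hparity 0 (Or.inl rfl)⟩, ?_⟩
  · rintro x hx y hy rfl
    exact (hmem y).1 hy hx
  · intro u hu hm
    set c := ∑ w ∈ X.erase u, w with hc
    have hXs : u + c = ∑ w ∈ X, w := add_sum_erase X (fun w => w) hu
    have hdc : (d : ZMod (2 * d)) * c = c := by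
      linear_combination c * hkd + (k : ZMod (2 * d)) * hm
    set S := X.image (· + -c) with hS
    have hSc : S.card = d := by rw [hS, card_image_add_right, hcard]
    have huS : u + -c ∈ S := mem_image_of_mem _ hu
    have hTc := card_erase_add_one huS
    obtain ⟨F, hF, hFX, hFS⟩ := (H S hSc).1 (S.erase (u + -c)) (erase_subset _ _)
      (fun h => by rw [h, card_empty] at hTc; omega)
      (fun h => by rw [h] at hTc; omega)
    have hcF := card_sdiff_add_card_inter F S
    rw [hFS, hF] at hcF
    obtain ⟨g, hg⟩ := card_eq_one.1 (show (F \ S).card = 1 by omega)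
    have hgS : g ∉ S := (mem_sdiff.1 (hg ▸ mem_singleton_self g : g ∈ F \ S)).2
    have hsum := sum_inter_add_sum_sdiff F S (fun i => i)
    have hSs := sum_image_add_right X (-c)
    have hTs := add_sum_erase S (fun i => i) huS
    rw [hFS, hg, sum_singleton] at hsum
    rw [← hS, hcard] at hSs
    have hval : ∑ i ∈ F, i = c + g := by
      linear_combination hTs - hsum + hSs - hXs - hdc
    refine hgS (mem_image.2 ⟨c + g, hval ▸ hFX, ?_⟩)
    ring

theorem ZMod.traces_of_conditions {d k : ℕ} [NeZero d] (hd : d = 2 * k + 1) (hk : 1 ≤ k)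
    {X : Finset (ZMod (2 * d))} (hX : X.card = d) (hXX : ∀ x ∈ X, ∀ y ∈ X, x ≠ d - y)
    (hodd : ∃ x ∈ X, (d : ZMod (2 * d)) * x = d) (heven : ∃ x ∈ X, (d : ZMod (2 * d)) * x = 0)
    (hsum : ∀ u ∈ X, 2 * ∑ w ∈ X.erase u, w ≠ 0)
    {S : Finset (ZMod (2 * d))} (hS : S.card = d) :
    (∀ T ⊆ S, T ≠ ∅ → T ≠ S → ∃ F, F.card = d ∧ ∑ i ∈ F, i ∈ X ∧ F ∩ S = T) ∧
      (∑ i ∈ S, i ∈ X ↔ ∑ i ∈ Sᶜ, i ∉ X) := by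
  have h2d := ZMod.two_mul_natCast_self d
  have hdpos := NeZero.pos d
  have hXc : Xᶜ.card = d := by rw [card_compl, ZMod.card, hX]; omega
  have hAc : Sᶜ.card = d := by rw [card_compl, ZMod.card, hS]; omega
  have hinj : Function.Injective (fun x : ZMod (2 * d) => d - x) := sub_right_injective
  have hcompl : X.image (fun x => (d : ZMod (2 * d)) - x) = Xᶜ := by
    refine eq_of_subset_of_card_le ?_ ?_
    · intro z hz
      obtain ⟨x, hx, rfl⟩ := mem_image.1 hz
      exact mem_compl.2 fun h => hXX _ h x hx rfl
    · rw [hXc, card_image_of_injective _ hinj, hX]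
  have hmem : ∀ r, r ∈ X ↔ d - r ∉ X := by
    intro r
    rw [← mem_compl, ← hcompl, mem_image]
    exact ⟨fun h => ⟨r, h, rfl⟩, fun ⟨x, hx, h⟩ => hinj h ▸ hx⟩
  have htrans : ∀ (B : Finset (ZMod (2 * d))) (e : ZMod (2 * d)), B.card = d →
      (∀ b ∈ B, b + e ∈ X) → X = B.image (· + e) := by
    intro B e hB h
    refine (eq_of_subset_of_card_le (image_subset_iff.2 h) ?_).symm
    rw [card_image_add_right, hB, hX]
  refine ⟨fun T hTS hT0 hTne => ?_, by rw [ZMod.sum_compl_two_mul]; exact hmem _⟩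
  by_contra! hcon
  have hTpos : 0 < T.card := card_pos.2 (nonempty_iff_ne_empty.2 hT0)
  have hTlt : T.card < S.card := card_lt_card (hTS.ssubset_of_ne hTne)
  have hY : ∀ G ⊆ Sᶜ, G.card = d - T.card → ∑ i ∈ T, i + ∑ i ∈ G, i ∈ Xᶜ := by
    intro G hG hGc
    have hdisj : Disjoint T G := (disjoint_compl_right (a := S)).mono hTS hG
    have hGS : G ∩ S = ∅ := by
      rw [← disjoint_iff_inter_eq_empty]
      exact ((disjoint_compl_right (a := S)).mono le_rfl hG).symm
    rw [mem_compl, ← sum_union hdisj]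
    intro h
    refine hcon (T ∪ G) ?_ h ?_
    · rw [card_union_of_disjoint hdisj, hGc]; omega
    · rw [union_inter_distrib_right, hGS, union_empty, inter_eq_left.2 hTS]
  rcases (show d - T.card = 1 ∨ T.card = 1 ∨ (2 ≤ d - T.card ∧ d - T.card + 2 ≤ d) by omega)
    with h | h | h
  · obtain ⟨v, hv⟩ := card_eq_one.1 (show (S \ T).card = 1 by
      rw [card_sdiff_of_subset hTS]; omega)
    have hvS : v ∈ S := (mem_sdiff.1 (hv ▸ mem_singleton_self v : v ∈ S \ T)).1
    have hTv := sum_sdiff hTS (f := fun i => i)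
    rw [hv, sum_singleton] at hTv
    have hcompl' : Sᶜ.image (· + ∑ i ∈ T, i) = Xᶜ := by
      refine eq_of_subset_of_card_le ?_ (by rw [card_image_add_right, hAc, hXc])
      refine image_subset_iff.2 fun a ha => ?_
      have := hY {a} (singleton_subset_iff.2 ha) (by rw [card_singleton, h])
      rwa [sum_singleton, add_comm] at this
    have hSX : ∀ b ∈ S, b + ∑ i ∈ T, i ∈ X := by
      intro b hb
      by_contra hbX
      rw [← mem_compl, ← hcompl'] at hbX
      obtain ⟨a, ha, hab⟩ := mem_image.1 hbX
      rw [add_left_injective _ hab] at ha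
      exact mem_compl.1 ha hb
    have hXS := htrans S _ hS hSX
    have hXs : ∑ i ∈ X, i = ∑ i ∈ S, i + d * ∑ i ∈ T, i := by
      conv_lhs => rw [hXS]
      rw [sum_image_add_right, hS]
    refine hsum _ (hSX v hvS) ?_
    have := add_sum_erase X (fun i => i) (hSX v hvS)
    linear_combination 2 * this + 2 * hXs - 2 * hTv + (∑ i ∈ T, i) * h2d
  · obtain ⟨t, rfl⟩ := card_eq_one.1 h
    have htS : t ∈ S := singleton_subset_iff.1 hTS
    set e := (d : ZMod (2 * d)) - t - ∑ i ∈ Sᶜ, i with he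
    have hAX : ∀ b ∈ Sᶜ, b + e ∈ X := by
      intro b hb
      have := hY (Sᶜ.erase b) (erase_subset _ _) (by rw [card_erase_of_mem hb, hAc, h])
      rw [mem_compl, sum_singleton] at this
      rw [hmem]
      have hs := add_sum_erase Sᶜ (fun i => i) hb
      have heq : d - (b + e) = t + ∑ i ∈ Sᶜ.erase b, i := by linear_combination -hs - he
      rwa [heq]
    have hXA := htrans _ _ hAc hAX
    have hXs : ∑ i ∈ X, i = ∑ i ∈ Sᶜ, i + d * e := by
      conv_lhs => rw [hXA]
      rw [sum_image_add_right, hAc]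
    have hte : t + e ∉ X := by
      rw [hXA]
      intro h'
      obtain ⟨a, ha, hab⟩ := mem_image.1 h'
      rw [add_left_injective _ hab] at ha
      exact mem_compl.1 ha htS
    have hu : d - (t + e) ∈ X := by rw [hmem, sub_sub_cancel]; exact hte
    refine hsum _ hu ?_
    have := add_sum_erase X (fun i => i) hu
    linear_combination 2 * this + 2 * hXs + e * h2d + 2 * he
  · have hpar := ZMod.half_mul_eq_of_subset_sums_mem_half hd hAc hXc h.1 h.2 hY
    obtain ⟨y, hy⟩ := card_pos.1 (show 0 < Xᶜ.card by omega)
    obtain ⟨x, hx, hxy⟩ : ∃ x ∈ X, (d : ZMod (2 * d)) * x = d * y := by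
      rcases ZMod.half_mul_eq_zero_or d y with h0 | h0 <;> rw [h0] <;> assumption
    have hsub : insert x Xᶜ ⊆
        ({z : ZMod (2 * d) | (d : ZMod (2 * d)) * z = d * y} : Finset (ZMod (2 * d))) := by
      intro z hz
      refine mem_filter.2 ⟨mem_univ _, ?_⟩
      rcases mem_insert.1 hz with rfl | hz
      · exact hxy
      · exact hpar z hz y hy
    have hle := (card_le_card hsub).trans (ZMod.card_filter_half_mul_eq_le d _)
    rw [card_insert_of_notMem (by simpa using hx), hXc] at hle
    omega

/-- The representative in `{1, …, 2d}` of a residue modulo `2d`. -/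
def ZMod.posRep (d : ℕ) [NeZero d] : ZMod (2 * d) ↪ ℕ where
  toFun z := (z - 1).val + 1
  inj' _ _ h := sub_left_injective (ZMod.val_injective _ (Nat.succ_injective h))

theorem ZMod.posRep_apply {d : ℕ} [NeZero d] (z : ZMod (2 * d)) :
    ZMod.posRep d z = (z - 1).val + 1 :=
  rfl

theorem ZMod.natCast_posRep {d : ℕ} [NeZero d] (z : ZMod (2 * d)) :
    ((ZMod.posRep d z : ℕ) : ZMod (2 * d)) = z := by
  simp [ZMod.posRep_apply]

theorem ZMod.map_posRep_univ (d : ℕ) [NeZero d] :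
    (univ : Finset (ZMod (2 * d))).map (ZMod.posRep d) = Icc 1 (2 * d) := by
  refine eq_of_subset_of_card_le (fun i hi => ?_) ?_
  · obtain ⟨z, -, rfl⟩ := mem_map.1 hi
    have := ZMod.val_lt (z - 1)
    rw [ZMod.posRep_apply, mem_Icc]
    omega
  · rw [card_map, card_univ, ZMod.card, Nat.card_Icc]; omega

theorem ZMod.exists_eq_map_posRep {d : ℕ} [NeZero d] {S : Finset ℕ} (hS : S ⊆ Icc 1 (2 * d)) :
    ∃ S' : Finset (ZMod (2 * d)), S = S'.map (ZMod.posRep d) := by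
  rw [← ZMod.map_posRep_univ, subset_map_iff] at hS
  obtain ⟨S', -, h⟩ := hS
  exact ⟨S', h⟩

theorem ZMod.natCast_sum_map_posRep {d : ℕ} [NeZero d] (S : Finset (ZMod (2 * d))) :
    ((∑ i ∈ S.map (ZMod.posRep d), i : ℕ) : ZMod (2 * d)) = ∑ i ∈ S, i := by
  rw [sum_map, Nat.cast_sum]
  exact sum_congr rfl fun i _ => ZMod.natCast_posRep i

theorem map_posRep_mem_familyTrace {d : ℕ} [NeZero d] {X S T : Finset (ZMod (2 * d))} :
    T.map (ZMod.posRep d) ∈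
        familyTrace (sumFamily d (X.map (ZMod.posRep d))) (S.map (ZMod.posRep d)) ↔
      ∃ F, F.card = d ∧ ∑ i ∈ F, i ∈ X ∧ F ∩ S = T := by
  simp only [familyTrace, sumFamily, mem_image, mem_filter, mem_powersetCard, mem_map,
    exists_exists_and_eq_and, ← ZMod.natCast_eq_natCast_iff, ZMod.natCast_posRep]
  constructor
  · rintro ⟨F, ⟨⟨hF, hFc⟩, x, hx, hFx⟩, h⟩
    obtain ⟨F, rfl⟩ := ZMod.exists_eq_map_posRep hF
    rw [ZMod.natCast_sum_map_posRep] at hFx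
    rw [card_map] at hFc
    rw [← map_inter] at h
    exact ⟨F, hFc, hFx ▸ hx, map_injective _ h⟩
  · rintro ⟨F, hFc, hFX, rfl⟩
    refine ⟨F.map (ZMod.posRep d), ⟨⟨?_, by rw [card_map, hFc]⟩, _, hFX, ?_⟩, by rw [map_inter]⟩
    · rw [← ZMod.map_posRep_univ]
      exact map_subset_map.2 (subset_univ F)
    · exact ZMod.natCast_sum_map_posRep F

theorem almostShatters_iff {𝓕 : Finset (Finset ℕ)} {S : Finset ℕ} (hS : S.Nonempty) :
    AlmostShatters 𝓕 S ↔
      (∀ T ⊆ S, T ≠ ∅ → T ≠ S → T ∈ familyTrace 𝓕 S) ∧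
        (S ∈ familyTrace 𝓕 S ↔ ∅ ∉ familyTrace 𝓕 S) := by
  have hsub : ∀ T ∈ familyTrace 𝓕 S, T ⊆ S := by
    intro T hT
    obtain ⟨F, -, rfl⟩ := mem_image.1 hT
    exact inter_subset_right
  have hne : S ≠ ∅ := hS.ne_empty
  unfold AlmostShatters
  generalize familyTrace 𝓕 S = 𝓣 at *
  simp only [Finset.ext_iff (α := Finset ℕ), mem_sdiff, mem_powerset, mem_singleton]
  constructor
  · rintro (h | h)
    · exact ⟨fun T h1 h2 _ => (h T).2 ⟨h1, h2⟩, fun _ h' => ((h ∅).1 h').2 rfl,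
        fun _ => (h S).2 ⟨Subset.rfl, hne⟩⟩
    · exact ⟨fun T h1 _ h2 => (h T).2 ⟨h1, h2⟩, fun h' => absurd rfl ((h S).1 h').2,
        fun h' => absurd ((h ∅).2 ⟨empty_subset S, hne.symm⟩) h'⟩
  · rintro ⟨h1, h2⟩
    by_cases hST : S ∈ 𝓣
    · refine Or.inl fun T => ⟨fun h => ⟨hsub T h, ?_⟩, fun h => ?_⟩
      · rintro rfl
        exact h2.1 hST h
      · by_cases hTS : T = S
        · rwa [hTS]
        · exact h1 T h.1 h.2 hTS
    · refine Or.inr fun T => ⟨fun h => ⟨hsub T h, ?_⟩, fun h => ?_⟩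
      · rintro rfl
        exact hST h
      · by_cases hT : T = ∅
        · rw [hT]
          by_contra h'
          exact hST (h2.2 h')
        · exact h1 T h.1 hT h.2

theorem almostShatters_map_posRep_iff {d : ℕ} [NeZero d] {X S : Finset (ZMod (2 * d))}
    (hS : S.card = d) :
    AlmostShatters (sumFamily d (X.map (ZMod.posRep d))) (S.map (ZMod.posRep d)) ↔
      (∀ T ⊆ S, T ≠ ∅ → T ≠ S → ∃ F, F.card = d ∧ ∑ i ∈ F, i ∈ X ∧ F ∩ S = T) ∧
        (∑ i ∈ S, i ∈ X ↔ ∑ i ∈ Sᶜ, i ∉ X) := by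
  have hne : S.Nonempty := card_pos.1 (hS.symm ▸ NeZero.pos d)
  rw [almostShatters_iff (hne.map), ← map_empty (ZMod.posRep d), map_posRep_mem_familyTrace,
    map_posRep_mem_familyTrace]
  refine and_congr ⟨fun h T hT h0 h1 => ?_, fun h T hT h0 h1 => ?_⟩ (iff_congr ?_ (not_congr ?_))
  · exact map_posRep_mem_familyTrace.1 (h _ (map_subset_map.2 hT)
      (fun h' => h0 (map_injective _ h')) (fun h' => h1 (map_injective _ h')))
  · obtain ⟨T, -, rfl⟩ := subset_map_iff.1 hT
    exact map_posRep_mem_familyTrace.2 (h T (map_subset_map.1 ‹_›) (fun h' => h0 (by rw [h']))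
      (fun h' => h1 (by rw [h'])))
  · constructor
    · rintro ⟨F, hF, hFX, hFS⟩
      have : S = F := eq_of_subset_of_card_le (inter_eq_right.1 hFS) (by rw [hF, hS])
      rwa [this]
    · exact fun h => ⟨S, hS, h, inter_self S⟩
  · have hAc : Sᶜ.card = d := by rw [card_compl, ZMod.card, hS]; omega
    constructor
    · rintro ⟨F, hF, hFX, hFS⟩
      have : F = Sᶜ := eq_of_subset_of_card_le
        (fun i hi => mem_compl.2 fun h => by
          exact notMem_empty i (hFS ▸ mem_inter.2 ⟨hi, h⟩)) (by rw [hF, hAc])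
      rwa [← this]
    · exact fun h => ⟨Sᶜ, hAc, h, by rw [inter_comm, inter_compl]⟩

theorem theorem4 (d k : ℕ) (hd : d = 2 * k + 1) (hk : 1 ≤ k)
    (X : Finset ℕ) (hX : X ⊆ Finset.Icc 1 (2 * d)) :
    (∀ S ∈ (Finset.Icc 1 (2 * d)).powersetCard d, AlmostShatters (sumFamily d X) S) ↔
      (X.card = d ∧ ∀ x ∈ X, ∀ y ∈ X, ¬ ((x : ℤ) ≡ (d : ℤ) - (y : ℤ) [ZMOD 2 * (d : ℤ)])) ∧
      ((∃ x ∈ X, Odd x) ∧ (∃ x ∈ X, Even x)) ∧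
      (∀ u ∈ X, ¬ (∑ w ∈ X.erase u, w ≡ 0 [MOD d])) := by
  have : NeZero d := ⟨by omega⟩
  obtain ⟨X, rfl⟩ := ZMod.exists_eq_map_posRep hX
  have hL : (∀ S ∈ (Finset.Icc 1 (2 * d)).powersetCard d,
      AlmostShatters (sumFamily d (X.map (ZMod.posRep d))) S) ↔
      ∀ S : Finset (ZMod (2 * d)), S.card = d →
        (∀ T ⊆ S, T ≠ ∅ → T ≠ S → ∃ F, F.card = d ∧ ∑ i ∈ F, i ∈ X ∧ F ∩ S = T) ∧
          (∑ i ∈ S, i ∈ X ↔ ∑ i ∈ Sᶜ, i ∉ X) := by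
    constructor
    · intro h S hS
      refine (almostShatters_map_posRep_iff hS).1 (h _ (mem_powersetCard.2 ⟨?_, ?_⟩))
      · rw [← ZMod.map_posRep_univ]
        exact map_subset_map.2 (subset_univ S)
      · rw [card_map, hS]
    · intro h S hS
      obtain ⟨hS, hSc⟩ := mem_powersetCard.1 hS
      obtain ⟨S, rfl⟩ := ZMod.exists_eq_map_posRep hS
      rw [card_map] at hSc
      exact (almostShatters_map_posRep_iff hSc).2 (h S hSc)
  have hmod : ∀ x y : ZMod (2 * d), ((ZMod.posRep d x : ℕ) : ℤ) ≡
      (d : ℤ) - (ZMod.posRep d y : ℕ) [ZMOD 2 * (d : ℤ)] ↔ x = d - y := by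
    intro x y
    rw [show (2 * (d : ℤ)) = ((2 * d : ℕ) : ℤ) by push_cast; rfl, ← ZMod.intCast_eq_intCast_iff]
    push_cast
    rw [ZMod.natCast_posRep, ZMod.natCast_posRep]
  have hev : ∀ x : ZMod (2 * d), Even (ZMod.posRep d x) ↔ (d : ZMod (2 * d)) * x = 0 := by
    intro x
    rw [← ZMod.half_mul_natCast_eq_zero_iff d, ZMod.natCast_posRep]
  have hod : ∀ x : ZMod (2 * d), Odd (ZMod.posRep d x) ↔ (d : ZMod (2 * d)) * x = d := by
    intro x
    rw [← Nat.not_even_iff_odd, hev]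
    exact ⟨(ZMod.half_mul_eq_zero_or d x).resolve_left,
      fun h h' => ZMod.natCast_half_ne_zero d (h.symm.trans h')⟩
  have hs : ∀ u : ZMod (2 * d),
      ∑ w ∈ (X.map (ZMod.posRep d)).erase (ZMod.posRep d u), w ≡ 0 [MOD d] ↔ 2 * ∑ w ∈ X.erase u, w = 0 := by
    intro u
    rw [← map_erase, Nat.modEq_zero_iff_dvd, ← ZMod.two_mul_natCast_eq_zero_iff,
      ZMod.natCast_sum_map_posRep]
  rw [hL, card_map]
  simp only [mem_map, forall_exists_index, and_imp, forall_apply_eq_imp_iff₂, exists_exists_and_eq_and, hmod, hev, hod, hs]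
  exact ⟨ZMod.conditions_of_traces hd hk, fun h S hS =>
    ZMod.traces_of_conditions hd hk h.1.1 h.1.2 h.2.1.1 h.2.1.2 h.2.2 hS⟩
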